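/- A partition is a sequence of integers $\lambda_1\ge\lambda_2\ge\cdots\ge 0$ that is eventually $0$; let $\mathbb{Y}$ be the set of all partitions. Write $|\lambda|=\sum_i\lambda_i$, $n(\lambda)=\sum_{i\ge 1}(i-1)\lambda_i$, let $\lambda'$ with $\lambda_i'=\#\{j:\lambda_j\ge i\}$ be the conjugate partition, and write $\lambda\succ\kappa$ if $\lambda_1\ge\kappa_1\ge\lambda_2\ge\kappa_2\ge\cdots$. For $d\in\mathbb{Z}_{\ge 0}$ let $\mathbb{Y}_d'$ be the set of partitions $\lambda$ such that $\lambda'$ has at most $d$ nonzero parts, i.e. $\lambda_1\le d$. For a prime $p$ put $G_\lambda=\bigoplus_i \mathbb{Z}/p^{\lambda_i}\mathbb{Z}$, and let $(a;q)_n=\prod_{i=1}^n(1-aq^{i-1})$. Let $\operatorname{Sur}(A,H)$ be the set of surjective group homomorphisms $A\to H$. **Theorem.** Fix a prime $p$ and $d\in\mathbb{Z}_{\ge 0}$, put $t=1/p$, and let $G$ be a random abelian group, possibly infinite, such that for each finite abelian group $H$ with $p^dH=0$ the quantity $\#\operatorname{Sur}(G,H)\in\{0,1,2,\ldots\}\cup\{\infty\}$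 is a random variable with finite expectation $M_H:=\mathbb{E}[\#\operatorname{Sur}(G,H)]<\infty$. Then for every $\nu\in\mathbb{Y}_d'$, $\{G/p^dG\cong G_\nu\}$ is an event (up to a null set) and $$\Pr(G/p^dG\cong G_\nu)=\sum_{\substack{\mu\in\mathbb{Y}_d'\\ \mu'\succ\nu'}}\frac{(-1)^{|\mu|-|\nu|}\,t^{\,n(\nu)+n(\mu)+|\mu|}}{\prod_{i\ge 1}(t;t)_{\mu_i'-\nu_i'}\,(t;t)_{\nu_i'-\mu_{i+1}'}}\,M_{G_\mu},$$ provided that the sum on the right-hand side converges absolutely. -/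

import Mathlib

open MeasureTheory
open scoped ENNReal

/-- The interlacing condition `κ ≺ l`, that is `l₁ ≥ κ₁ ≥ l₂ ≥ κ₂ ≥ ⋯`, on integer partitions.
Partitions are Young diagrams: with indices from `0`, `l.rowLen i` is the part `l_{i+1}`,
`l.transpose` is the conjugate partition `l'`, `l.colLen 0` is the number of nonzero parts and
`l.card` is the size `|l|`. -/
def Interlaces (κ l : YoungDiagram) : Prop :=
  ∀ i : ℕ, κ.rowLen i ≤ l.rowLen i ∧ l.rowLen (i + 1) ≤ κ.rowLen i

/-- The set of partitions `l` whose conjugate has at most `d` nonzero parts. -/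
def partitionsConjLenLE (d : ℕ) : Set YoungDiagram :=
  {l | l.transpose.colLen 0 ≤ d}

/-- `n(l) = ∑_{i ≥ 1} (i - 1) l_i`; the parts beyond the length of `l` vanish. -/
def nStat (l : YoungDiagram) : ℕ :=
  ∑ i ∈ Finset.range (l.colLen 0), i * l.rowLen i

/-- The group `G_l = ⨁_i ℤ / p ^ (l_i) ℤ`, the sum being over the (finitely many) nonzero parts. -/
abbrev GroupOfPartition (p : ℕ) (l : YoungDiagram) : Type :=
  (i : Fin (l.colLen 0)) → ZMod (p ^ l.rowLen i)

/-- The finite `q`-Pochhammer symbol `(a; q)_n = ∏_{i=1}^n (1 - a q^{i-1})`. -/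
noncomputable def qPoch (a q : ℝ) (n : ℕ) : ℝ :=
  ∏ i ∈ Finset.range n, (1 - a * q ^ i)

/-- The number of surjective homomorphisms `A → H`, in `ℕ ∪ {∞}` and seen as an element of
`[0, ∞]`. -/
noncomputable def surCount (A H : Type*) [AddCommGroup A] [AddCommGroup H] : ℝ≥0∞ :=
  ((ENat.card {f : A →+ H // Function.Surjective f} : ℕ∞) : ℝ≥0∞)

/-- The `H`-moment `𝔼[#Sur(G, H)] ∈ [0, ∞]` of the random abelian group `G`. -/
noncomputable def groupMoment {Ω : Type*} [MeasurableSpace Ω] (P : Measure Ω) (G : Ω → Type*)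
    [∀ ω, AddCommGroup (G ω)] (H : Type*) [AddCommGroup H] : ℝ≥0∞ :=
  ∫⁻ ω, surCount (G ω) H ∂P

/-- The subgroup `m A = {m a : a ∈ A}` of an abelian group `A`. -/
abbrev multiplesSubgroup (m : ℕ) (A : Type*) [AddCommGroup A] : AddSubgroup A :=
  (nsmulAddMonoidHom m : A →+ A).range

/-- The coefficient
`(-1)^{|μ|-|ν|} t^{n(ν)+n(μ)+|μ|} / ∏_{i ≥ 1} (t;t)_{μ'_i - ν'_i} (t;t)_{ν'_i - μ'_{i+1}}`.
It is only used when `ν' ≺ μ'`; then no subtraction is truncated, and all but finitely many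
factors of the product are `1`. -/
noncomputable def inversionCoeff (t : ℝ) (ν μ : YoungDiagram) : ℝ :=
  (-1) ^ (μ.card - ν.card) * t ^ (nStat ν + nStat μ + μ.card) /
    ∏ᶠ i : ℕ, (qPoch t t (μ.transpose.rowLen i - ν.transpose.rowLen i) *
      qPoch t t (ν.transpose.rowLen i - μ.transpose.rowLen (i + 1)))

namespace YoungDiagram

theorem lt_colLen_iff_lt_rowLen (μ : YoungDiagram) (i j : ℕ) : i < μ.colLen j ↔ j < μ.rowLen i := by
  rw [← mem_iff_lt_colLen, mem_iff_lt_rowLen]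

theorem ext_colLen {μ ν : YoungDiagram} (h : ∀ k, μ.colLen k = ν.colLen k) : μ = ν := by
  ext ⟨i, j⟩
  rw [mem_cells, mem_cells, mem_iff_lt_colLen, mem_iff_lt_colLen, h]

theorem colLen_eq_zero {μ : YoungDiagram} {d k : ℕ} (h : μ.rowLen 0 ≤ d) (hk : d ≤ k) :
    μ.colLen k = 0 := by
  by_contra hne
  have := (μ.lt_colLen_iff_lt_rowLen 0 k).1 (Nat.pos_of_ne_zero hne)
  omega

theorem rowLen_zero_le {μ : YoungDiagram} {d : ℕ} (h : μ.colLen d = 0) : μ.rowLen 0 ≤ d := by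
  by_contra! hlt
  have := (μ.lt_colLen_iff_lt_rowLen 0 d).2 hlt
  omega

/-- The Young diagram with column lengths `x 0, …, x (d - 1)`. -/
def ofColLens (d : ℕ) (x : ℕ → ℕ) (hx : Antitone x) : YoungDiagram where
  cells := (Finset.range (x 0) ×ˢ Finset.range d).filter fun c => c.1 < x c.2
  isLowerSet := by
    rintro ⟨i, j⟩ ⟨i', j'⟩ ⟨hi, hj⟩ h
    simp only [Finset.coe_filter, Finset.mem_product, Finset.mem_range, Set.mem_ofPred_eq] at *
    have h₁ : x j ≤ x j' := hx hj
    have h₂ : x j' ≤ x 0 := hx (Nat.zero_le _)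
    omega

theorem colLen_ofColLens {d : ℕ} {x : ℕ → ℕ} (hx : Antitone x) (k : ℕ) :
    (ofColLens d x hx).colLen k = if k < d then x k else 0 := by
  have key : ∀ i, i < (ofColLens d x hx).colLen k ↔ i < if k < d then x k else 0 := by
    intro i
    rw [← mem_iff_lt_colLen, ← mem_cells]
    have h₂ : x k ≤ x 0 := hx (Nat.zero_le _)
    simp only [ofColLens, Finset.mem_filter, Finset.mem_product, Finset.mem_range]
    split_ifs <;> omega
  exact le_antisymm (le_of_forall_lt fun i hi => (key i).1 hi)
    (le_of_forall_lt fun i hi => (key i).2 hi)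

@[to_additive]
theorem prod_rows_eq_prod_cols {M : Type*} [CommMonoid M] {μ : YoungDiagram} {d : ℕ}
    (h : μ.rowLen 0 ≤ d) (f : ℕ → ℕ → M) :
    ∏ i ∈ Finset.range (μ.colLen 0), ∏ j ∈ Finset.range (μ.rowLen i), f i j =
      ∏ j ∈ Finset.range d, ∏ i ∈ Finset.range (μ.colLen j), f i j := by
  refine Finset.prod_comm' fun i j => ?_
  simp only [Finset.mem_range, lt_colLen_iff_lt_rowLen]
  have := μ.rowLen_anti 0 i (Nat.zero_le _)
  omega

theorem prod_row_ends {M : Type*} [CommMonoid M] {μ : YoungDiagram} {d : ℕ}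
    (h : μ.rowLen 0 ≤ d) (f : ℕ → ℕ → M) :
    ∏ i ∈ Finset.range (μ.colLen 0), f i (μ.rowLen i - 1) =
      ∏ k ∈ Finset.range d, ∏ i ∈ Finset.Ico (μ.colLen (k + 1)) (μ.colLen k), f i k := by
  have key : ∀ i k, i ∈ Finset.Ico (μ.colLen (k + 1)) (μ.colLen k) ↔ μ.rowLen i = k + 1 := by
    intro i k
    rw [Finset.mem_Ico, ← not_lt, lt_colLen_iff_lt_rowLen, lt_colLen_iff_lt_rowLen]
    omega
  have hmaps : ∀ i ∈ Finset.range (μ.colLen 0), μ.rowLen i - 1 ∈ Finset.range d := by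
    intro i hi
    rw [Finset.mem_range, lt_colLen_iff_lt_rowLen] at hi
    have := μ.rowLen_anti 0 i (Nat.zero_le _)
    rw [Finset.mem_range]
    omega
  rw [← Finset.prod_fiberwise_of_maps_to hmaps]
  refine Finset.prod_congr rfl fun k _ => ?_
  have hfil : (Finset.range (μ.colLen 0)).filter (fun i => μ.rowLen i - 1 = k) =
      Finset.Ico (μ.colLen (k + 1)) (μ.colLen k) := by
    ext i
    rw [key, Finset.mem_filter, Finset.mem_range, lt_colLen_iff_lt_rowLen]
    omega
  rw [hfil]
  refine Finset.prod_congr rfl fun i hi => ?_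
  rw [(key i k).1 hi, Nat.add_sub_cancel]

theorem card_eq_sum_colLen {μ : YoungDiagram} {d : ℕ} (h : μ.rowLen 0 ≤ d) :
    μ.card = ∑ k ∈ Finset.range d, μ.colLen k := by
  have hmaps : ∀ c ∈ μ.cells, c.2 ∈ Finset.range d := by
    rintro ⟨i, j⟩ hc
    rw [mem_cells, mem_iff_lt_rowLen] at hc
    have := μ.rowLen_anti 0 i (Nat.zero_le _)
    rw [Finset.mem_range]
    omega
  refine (Finset.card_eq_sum_card_fiberwise hmaps).trans (Finset.sum_congr rfl fun k _ => ?_)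
  rw [colLen_eq_card, col]

end YoungDiagram

theorem nStat_eq_sum_choose {μ : YoungDiagram} {d : ℕ} (h : μ.rowLen 0 ≤ d) :
    nStat μ = ∑ k ∈ Finset.range d, (μ.colLen k).choose 2 := by
  have := YoungDiagram.sum_rows_eq_sum_cols h (fun i _ => i)
  simp only [Finset.sum_const, Finset.card_range, smul_eq_mul] at this
  rw [nStat, Finset.sum_congr rfl fun i _ => mul_comm i _, this]
  exact Finset.sum_congr rfl fun k _ => by rw [Finset.sum_range_id, Nat.choose_two_right]

theorem mem_partitionsConjLenLE_iff {d : ℕ} {μ : YoungDiagram} :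
    μ ∈ partitionsConjLenLE d ↔ μ.rowLen 0 ≤ d := by
  rw [partitionsConjLenLE, Set.mem_ofPred_eq, YoungDiagram.colLen_transpose]

theorem interlaces_transpose_iff {ν μ : YoungDiagram} :
    Interlaces ν.transpose μ.transpose ↔
      ∀ k, ν.colLen k ≤ μ.colLen k ∧ μ.colLen (k + 1) ≤ ν.colLen k := by
  simp only [Interlaces, YoungDiagram.rowLen_transpose]

theorem qPoch_self_succ (t : ℝ) (n : ℕ) :
    qPoch t t (n + 1) = qPoch t t n * (1 - t ^ (n + 1)) := by
  rw [qPoch, Finset.prod_range_succ, pow_succ' t n, qPoch]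

theorem qPoch_self_zero (t : ℝ) : qPoch t t 0 = 1 := by
  simp [qPoch]

theorem one_sub_pow_ne_zero {t : ℝ} (h0 : 0 < t) (h1 : t < 1) {n : ℕ} (hn : n ≠ 0) :
    1 - t ^ n ≠ 0 :=
  (sub_pos.2 (pow_lt_one₀ h0.le h1 hn)).ne'

theorem qPoch_self_ne_zero {t : ℝ} (h0 : 0 < t) (h1 : t < 1) (n : ℕ) : qPoch t t n ≠ 0 := by
  induction n with
  | zero => rw [qPoch_self_zero]; exact one_ne_zero
  | succ n ih =>
    rw [qPoch_self_succ]
    exact mul_ne_zero ih (one_sub_pow_ne_zero h0 h1 n.succ_ne_zero)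

theorem prod_Ico_one_sub_pow {t : ℝ} (h0 : 0 < t) (h1 : t < 1) {a y : ℕ} {x : ℕ} (hyx : y ≤ x)
    (hxa : x ≤ a) :
    ∏ i ∈ Finset.Ico y x, (1 - t ^ (a - i)) = qPoch t t (a - y) / qPoch t t (a - x) := by
  induction x, hyx using Nat.le_induction with
  | base => rw [Finset.Ico_self, Finset.prod_empty, div_self (qPoch_self_ne_zero h0 h1 _)]
  | succ x hyx ih =>
    have e : a - x = a - (x + 1) + 1 := by omega
    rw [Finset.prod_Ico_succ_top hyx, ih (by omega), e, qPoch_self_succ]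
    have h2 := qPoch_self_ne_zero h0 h1 (a - (x + 1))
    have h3 := one_sub_pow_ne_zero h0 h1 (Nat.succ_ne_zero (a - (x + 1)))
    field_simp

theorem add_choose_two (n s : ℕ) :
    (n + s).choose 2 = n.choose 2 + s.choose 2 + n * s := by
  induction s with
  | zero => simp
  | succ s ih =>
    rw [← add_assoc, Nat.choose_succ_succ' (n + s) 1, ih, Nat.choose_succ_succ' s 1]
    simp only [Nat.choose_one_right]
    ring

/-- Partial sums of the alternating `q`-binomial sum, in closed form. -/
theorem sum_range_qBinomial {t u : ℝ} (h0 : 0 < t) (h1 : t < 1) (htu : t * u = 1) (m M : ℕ) :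
    ∑ s ∈ Finset.range (m + 1), (-1) ^ s * t ^ (s.choose 2 + s) * u ^ ((m + M + 1) * s) /
        (qPoch t t s * qPoch t t (m + M + 1 - s)) =
      (-1) ^ m * t ^ ((m + 1).choose 2) * u ^ ((m + M + 1) * m) /
        (qPoch t t m * qPoch t t M * (1 - t ^ (m + M + 1))) := by
  induction m generalizing M with
  | zero =>
    simp [qPoch_self_zero, qPoch_self_succ]
  | succ m ih =>
    have ih' := ih (M + 1)
    have e1 : m + (M + 1) + 1 = m + 1 + M + 1 := by ring
    have e2 : m + 1 + M + 1 - (m + 1) = M + 1 := by omega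
    rw [e1] at ih'
    rw [Finset.sum_range_succ, ih', e2, qPoch_self_succ t M, qPoch_self_succ t m,
      Nat.choose_succ_succ' (m + 1) 1, Nat.choose_one_right]
    have hu : u ^ ((m + 1 + M + 1) * (m + 1)) =
        u ^ ((m + 1 + M + 1) * m) * u ^ (m + 1 + M + 1) := by
      rw [← pow_add]; ring_nf
    have hN : t ^ (m + 1) * t ^ (M + 1) * u ^ (m + 1 + M + 1) = 1 := by
      rw [← pow_add, ← add_assoc, ← mul_pow, htu, one_pow]
    have hNt : t ^ (m + 1 + M + 1) = t ^ (m + 1) * t ^ (M + 1) := by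
      rw [← pow_add, ← add_assoc]
    have n1 := qPoch_self_ne_zero h0 h1 m
    have n2 := qPoch_self_ne_zero h0 h1 M
    have n3 := one_sub_pow_ne_zero h0 h1 (Nat.succ_ne_zero M)
    have n4 := one_sub_pow_ne_zero h0 h1 (Nat.succ_ne_zero m)
    have n5 := one_sub_pow_ne_zero h0 h1 (Nat.succ_ne_zero (m + 1 + M))
    rw [Nat.succ_eq_add_one] at n3 n4 n5
    rw [hu, add_comm (m + 1) ((m + 1).choose 2), pow_add t ((m + 1).choose 2), pow_succ (-1 : ℝ) m]
    generalize t ^ ((m + 1).choose 2) = T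
    generalize u ^ ((m + 1 + M + 1) * m) = U at *
    generalize u ^ (m + 1 + M + 1) = V at *
    rw [hNt] at n5 ⊢
    generalize t ^ (m + 1) = x at *
    generalize t ^ (M + 1) = y at *
    have n5' : 1 - y * x ≠ 0 := by rwa [mul_comm]
    field_simp
    linear_combination (x - 1) * T * U * hN

theorem sum_qBinomial_eq_zero {t u : ℝ} (h0 : 0 < t) (h1 : t < 1) (htu : t * u = 1) {N : ℕ}
    (hN : N ≠ 0) :
    ∑ s ∈ Finset.range (N + 1), (-1) ^ s * t ^ (s.choose 2 + s) * u ^ (N * s) /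
        (qPoch t t s * qPoch t t (N - s)) = 0 := by
  obtain ⟨m, rfl⟩ := Nat.exists_eq_succ_of_ne_zero hN
  have key := sum_range_qBinomial h0 h1 htu m 0
  rw [add_zero] at key
  rw [Nat.succ_eq_add_one, Finset.sum_range_succ, key, Nat.sub_self, qPoch_self_succ, qPoch_self_zero]
  have hu : u ^ ((m + 1) * (m + 1)) = u ^ ((m + 1) * m) * u ^ (m + 1) := by
    rw [← pow_add]; ring_nf
  have hm : t ^ (m + 1) * u ^ (m + 1) = 1 := by rw [← mul_pow, htu, one_pow]
  have n1 := qPoch_self_ne_zero h0 h1 m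
  have n4 := one_sub_pow_ne_zero h0 h1 (Nat.succ_ne_zero m)
  rw [Nat.succ_eq_add_one] at n4
  rw [hu, pow_add t ((m + 1).choose 2), pow_succ (-1 : ℝ) m]
  field_simp
  linear_combination (-((-1) ^ m * t ^ ((m + 1).choose 2) * u ^ ((m + 1) * m))) * hm

/-- The factor of `coefficient × number of surjections` that depends on a single column length. -/
noncomputable def columnFactor (t u : ℝ) (a n y : ℕ) : ℝ :=
  (-1) ^ (y - n) * t ^ (n.choose 2 + y.choose 2 + y) * u ^ (a * y) /
    (qPoch t t (y - n) * qPoch t t (a - y))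

theorem sum_columnFactor {t u : ℝ} (h0 : 0 < t) (h1 : t < 1) (htu : t * u = 1) (a n : ℕ) :
    ∑ y ∈ Finset.Icc n a, columnFactor t u a n y = if a = n then 1 else 0 := by
  rcases lt_or_ge a n with han | han
  · rw [Finset.Icc_eq_empty (by omega), Finset.sum_empty, if_neg (by omega)]
  obtain ⟨N, rfl⟩ := Nat.exists_eq_add_of_le han
  have hterm : ∀ s ∈ Finset.range (N + 1), columnFactor t u (n + N) n (n + s) =
      t ^ (2 * n.choose 2 + n) * u ^ ((n + N) * n) *
        ((-1) ^ s * t ^ (s.choose 2 + s) * u ^ (N * s) / (qPoch t t s * qPoch t t (N - s))) := by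
    intro s _
    have hns : t ^ (n * s) * u ^ (n * s) = 1 := by rw [← mul_pow, htu, one_pow]
    have e1 : n.choose 2 + (n + s).choose 2 + (n + s) =
        (2 * n.choose 2 + n) + (s.choose 2 + s) + n * s := by rw [add_choose_two]; ring
    have e2 : (n + N) * (n + s) = (n + N) * n + N * s + n * s := by ring
    rw [columnFactor, e1, e2, Nat.add_sub_cancel_left, Nat.add_sub_add_left, pow_add t _ (n * s),
      pow_add t (2 * n.choose 2 + n), pow_add u _ (n * s), pow_add u _ (N * s), ← mul_div_assoc]
    congr 1
    linear_combination ((-1) ^ s * t ^ (2 * n.choose 2 + n) * t ^ (s.choose 2 + s) *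
      u ^ ((n + N) * n) * u ^ (N * s)) * hns
  rw [← Finset.Ico_add_one_right_eq_Icc, Finset.sum_Ico_eq_sum_range,
    show n + N + 1 - n = N + 1 by omega, Finset.sum_congr rfl hterm, ← Finset.mul_sum]
  split_ifs with h
  · obtain rfl : N = 0 := by omega
    have e : 2 * n.choose 2 + n = n * n := by
      rw [Nat.choose_two_right, Nat.mul_div_cancel' (Nat.even_mul_pred_self n).two_dvd]
      cases n <;> simp; ring
    simp only [zero_add, Finset.sum_range_one, e, add_zero, pow_zero, Nat.choose_zero_succ, mul_zero,
      Nat.sub_self, qPoch_self_zero, mul_one, div_one]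
    rw [← mul_pow, htu, one_pow]
  · rw [sum_qBinomial_eq_zero h0 h1 htu (by omega), mul_zero]

/-- The number of surjections onto `GroupOfPartition p μ` from a group `A` with
`#Hom(A, ℤ / p ^ e) = p ^ (a 0 + ⋯ + a (e - 1))`. -/
def surNumber (p : ℕ) (a : ℕ → ℕ) (μ : YoungDiagram) : ℕ :=
  ∏ i ∈ Finset.range (μ.colLen 0),
    p ^ (∑ j ∈ Finset.range (μ.rowLen i - 1), a j) * (p ^ a (μ.rowLen i - 1) - p ^ i)

theorem surNumber_eq_zero (p : ℕ) {a : ℕ → ℕ} (ha : Antitone a) {μ : YoungDiagram} {k : ℕ}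
    (hk : a k < μ.colLen k) : surNumber p a μ = 0 := by
  obtain ⟨K, hK, hK'⟩ : ∃ K, a K < μ.colLen K ∧ μ.colLen (K + 1) ≤ a (K + 1) := by
    by_contra! hne
    have : ∀ m, a (k + m) < μ.colLen (k + m) := by
      intro m
      induction m with
      | zero => exact hk
      | succ m ih => exact hne _ ih
    have h1 := this (μ.rowLen 0)
    rw [YoungDiagram.colLen_eq_zero le_rfl (Nat.le_add_left _ _)] at h1
    exact absurd h1 (Nat.not_lt_zero _)
  have hle : μ.colLen (K + 1) ≤ a K := hK'.trans (ha K.le_succ)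
  have h0 : a K < μ.colLen 0 := hK.trans_le (μ.colLen_anti _ _ (Nat.zero_le _))
  have hrow : μ.rowLen (a K) = K + 1 := by
    rw [YoungDiagram.lt_colLen_iff_lt_rowLen] at hK
    rw [← not_lt, YoungDiagram.lt_colLen_iff_lt_rowLen] at hle
    omega
  refine Finset.prod_eq_zero (Finset.mem_range.2 h0) ?_
  rw [hrow, Nat.add_sub_cancel, Nat.sub_self, mul_zero]

theorem surNumber_ne_zero {p : ℕ} (hp : 1 < p) {a : ℕ → ℕ} {μ : YoungDiagram}
    (h : ∀ k, k < μ.rowLen 0 → μ.colLen k ≤ a k) : surNumber p a μ ≠ 0 := by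
  refine Finset.prod_ne_zero_iff.2 fun i hi => ?_
  rw [Finset.mem_range, YoungDiagram.lt_colLen_iff_lt_rowLen] at hi
  have h1 : i < μ.colLen (μ.rowLen i - 1) := by
    rw [YoungDiagram.lt_colLen_iff_lt_rowLen]; omega
  have h2 := h (μ.rowLen i - 1) (by have := μ.rowLen_anti 0 i (Nat.zero_le _); omega)
  have h3 := Nat.pow_lt_pow_right hp (h1.trans_le h2)
  exact mul_ne_zero (pow_ne_zero _ (by omega)) (by omega)

theorem surNumber_eq_prod {p : ℕ} (hp : 1 < p) {a : ℕ → ℕ} {μ : YoungDiagram} {d : ℕ}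
    (hd : μ.rowLen 0 ≤ d) (h : ∀ k < d, μ.colLen k ≤ a k) :
    (surNumber p a μ : ℝ) = ∏ k ∈ Finset.range d, (p : ℝ) ^ (a k * μ.colLen k) *
      (qPoch (1 / (p : ℝ)) (1 / (p : ℝ)) (a k - μ.colLen (k + 1)) /
        qPoch (1 / (p : ℝ)) (1 / (p : ℝ)) (a k - μ.colLen k)) := by
  have hp0 : (0 : ℝ) < p := by exact_mod_cast (by omega : 0 < p)
  have ht0 : 0 < 1 / (p : ℝ) := by positivity
  have ht1 : 1 / (p : ℝ) < 1 := by
    rw [div_lt_one hp0]; exact_mod_cast hp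
  have hfac : ∀ i ∈ Finset.range (μ.colLen 0),
      ((p ^ (∑ j ∈ Finset.range (μ.rowLen i - 1), a j) *
        (p ^ a (μ.rowLen i - 1) - p ^ i) : ℕ) : ℝ) =
      (∏ j ∈ Finset.range (μ.rowLen i), (p : ℝ) ^ a j) *
        (1 - (1 / (p : ℝ)) ^ (a (μ.rowLen i - 1) - i)) := by
    intro i hi
    rw [Finset.mem_range, YoungDiagram.lt_colLen_iff_lt_rowLen] at hi
    obtain ⟨r, hr⟩ := Nat.exists_eq_add_of_lt hi
    have hr' : μ.rowLen i = r + 1 := by omega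
    have h1 : i < μ.colLen r := by
      rw [YoungDiagram.lt_colLen_iff_lt_rowLen]; omega
    have h2 := h r (by have := μ.rowLen_anti 0 i (Nat.zero_le _); omega)
    rw [hr', Nat.add_sub_cancel, Finset.prod_range_succ, Finset.prod_pow_eq_pow_sum, Nat.cast_mul,
      Nat.cast_sub (Nat.pow_le_pow_right (by omega) (by omega))]
    push_cast
    have h3 : (p : ℝ) ^ a r = p ^ (a r - i) * p ^ i := by rw [← pow_add]; congr 1; omega
    rw [one_div, inv_pow, h3]
    field_simp
  rw [surNumber, Nat.cast_prod, Finset.prod_congr rfl hfac, Finset.prod_mul_distrib,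
    YoungDiagram.prod_rows_eq_prod_cols hd (fun _ j => (p : ℝ) ^ a j),
    YoungDiagram.prod_row_ends hd (fun i k => 1 - (1 / (p : ℝ)) ^ (a k - i)),
    ← Finset.prod_mul_distrib]
  refine Finset.prod_congr rfl fun k hk => ?_
  rw [prod_Ico_one_sub_pow ht0 ht1 (μ.colLen_anti _ _ k.le_succ) (h k (Finset.mem_range.1 hk)),
    Finset.prod_const, Finset.card_range, ← pow_mul]

theorem inversionCoeff_eq_prod {t : ℝ} {ν μ : YoungDiagram} {d : ℕ} (hν : ν.rowLen 0 ≤ d)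
    (hμ : μ.rowLen 0 ≤ d) (h : ∀ k, ν.colLen k ≤ μ.colLen k) :
    inversionCoeff t ν μ = ∏ k ∈ Finset.range d,
      ((-1) ^ (μ.colLen k - ν.colLen k) *
        t ^ ((ν.colLen k).choose 2 + (μ.colLen k).choose 2 + μ.colLen k) /
        (qPoch t t (μ.colLen k - ν.colLen k) * qPoch t t (ν.colLen k - μ.colLen (k + 1)))) := by
  have hfin : ∏ᶠ i : ℕ, (qPoch t t (μ.transpose.rowLen i - ν.transpose.rowLen i) *
      qPoch t t (ν.transpose.rowLen i - μ.transpose.rowLen (i + 1))) =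
      ∏ i ∈ Finset.range d, (qPoch t t (μ.colLen i - ν.colLen i) *
        qPoch t t (ν.colLen i - μ.colLen (i + 1))) := by
    simp only [YoungDiagram.rowLen_transpose]
    refine finprod_eq_prod_of_mulSupport_subset _ fun i hi => ?_
    rw [Finset.coe_range, Set.mem_Iio]
    by_contra! hdi
    refine hi ?_
    simp only [YoungDiagram.colLen_eq_zero hν hdi, YoungDiagram.colLen_eq_zero hμ hdi,
      Nat.zero_sub, qPoch_self_zero, mul_one]
  rw [inversionCoeff, hfin, Finset.prod_div_distrib,
    Finset.prod_mul_distrib (f := fun k => (-1 : ℝ) ^ (μ.colLen k - ν.colLen k)),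
    Finset.prod_pow_eq_pow_sum, Finset.prod_pow_eq_pow_sum, Finset.sum_add_distrib,
    Finset.sum_add_distrib, nStat_eq_sum_choose hν, nStat_eq_sum_choose hμ,
    YoungDiagram.card_eq_sum_colLen hν, YoungDiagram.card_eq_sum_colLen hμ,
    Finset.sum_tsub_distrib _ fun k _ => h k]

/-- The factor of `coefficient × number of surjections` that links consecutive columns. -/
noncomputable def linkFactor (t : ℝ) (a n : ℕ → ℕ) : ℕ → ℕ → ℝ
  | 0, _ => 1
  | k + 1, y => qPoch t t (a k - y) / qPoch t t (n k - y)

/-- The values a column length may take. -/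
def columnRange (a n : ℕ → ℕ) : ℕ → Finset ℕ
  | 0 => Finset.Icc (n 0) (a 0)
  | k + 1 => Finset.Icc (n (k + 1)) (min (a (k + 1)) (n k))

theorem inversionCoeff_mul_surNumber {p : ℕ} (hp : 1 < p) {a : ℕ → ℕ} {ν μ : YoungDiagram} {d : ℕ}
    (hν : ν.rowLen 0 ≤ d) (hμ : μ.rowLen 0 ≤ d) (h : ∀ k, ν.colLen k ≤ μ.colLen k)
    (ha : ∀ k < d, μ.colLen k ≤ a k) :
    inversionCoeff (1 / (p : ℝ)) ν μ * surNumber p a μ =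
      (∏ k ∈ Finset.range d,
        columnFactor (1 / (p : ℝ)) p (a k) (ν.colLen k) (μ.colLen k) *
          linkFactor (1 / (p : ℝ)) a ν.colLen k (μ.colLen k)) *
        linkFactor (1 / (p : ℝ)) a ν.colLen d 0 := by
  rw [inversionCoeff_eq_prod hν hμ h, surNumber_eq_prod hp hμ ha, ← Finset.prod_mul_distrib,
    Finset.prod_mul_distrib (g := fun k => linkFactor (1 / (p : ℝ)) a ν.colLen k (μ.colLen k)),
    mul_assoc, ← YoungDiagram.colLen_eq_zero hμ le_rfl, ← Finset.prod_range_succ,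
    Finset.prod_range_succ']
  simp only [linkFactor, mul_one]
  rw [← Finset.prod_mul_distrib]
  refine Finset.prod_congr rfl fun k _ => ?_
  rw [columnFactor]
  simp only [div_eq_mul_inv, mul_inv]
  ring

theorem sum_prod_columns {p : ℕ} (hp : 1 < p) {a n : ℕ → ℕ} (ha : Antitone a) (d : ℕ) :
    (∑ x ∈ Fintype.piFinset (fun k : Fin d => columnRange a n k),
      (∏ k : Fin d, columnFactor (1 / (p : ℝ)) p (a k) (n k) (x k) *
          linkFactor (1 / (p : ℝ)) a n k (x k))) * linkFactor (1 / (p : ℝ)) a n d 0 =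
      if ∀ k < d, a k = n k then 1 else 0 := by
  have hp0 : (0 : ℝ) < p := by exact_mod_cast (by omega : 0 < p)
  have ht0 : 0 < 1 / (p : ℝ) := by positivity
  have ht1 : 1 / (p : ℝ) < 1 := by
    rw [div_lt_one hp0]; exact_mod_cast hp
  have key : ∀ k, (∀ j < k, a j = n j) →
      ∑ y ∈ columnRange a n k, columnFactor (1 / (p : ℝ)) p (a k) (n k) y *
        linkFactor (1 / (p : ℝ)) a n k y = if a k = n k then 1 else 0 := by
    intro k hk
    rw [← sum_columnFactor ht0 ht1 (one_div_mul_cancel hp0.ne')]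
    cases k with
    | zero => simp only [columnRange, linkFactor, mul_one]
    | succ k =>
      have h1 : min (a (k + 1)) (n k) = a (k + 1) := by
        rw [← hk k k.lt_succ_self]; exact min_eq_left (ha k.le_succ)
      rw [columnRange, h1]
      refine Finset.sum_congr rfl fun y _ => ?_
      rw [linkFactor, hk k k.lt_succ_self, div_self (qPoch_self_ne_zero ht0 ht1 _), mul_one]
  rw [← Finset.prod_univ_sum (fun k : Fin d => columnRange a n k)
    (fun k y => columnFactor (1 / (p : ℝ)) p (a k) (n k) y * linkFactor (1 / (p : ℝ)) a n k y),
    Fin.prod_univ_eq_prod_range (fun k => ∑ y ∈ columnRange a n k,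
    columnFactor (1 / (p : ℝ)) p (a k) (n k) y * linkFactor (1 / (p : ℝ)) a n k y)]
  split_ifs with h
  · rw [Finset.prod_eq_one, one_mul]
    · cases d with
      | zero => rfl
      | succ d =>
        rw [linkFactor, h d d.lt_succ_self, div_self (qPoch_self_ne_zero ht0 ht1 _)]
    · intro k hk
      rw [Finset.mem_range] at hk
      rw [key k fun j hj => h j (hj.trans hk), if_pos (h k hk)]
  · classical
    push Not at h
    obtain ⟨hlt, hne⟩ := Nat.find_spec h
    rw [Finset.prod_eq_zero (Finset.mem_range.2 hlt), zero_mul]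
    rw [key, if_neg hne]
    intro j hj
    by_contra hj'
    exact Nat.find_min h hj ⟨hj.trans hlt, hj'⟩

/-- The sequence that extends a tuple by zeros. -/
def extendByZero {d : ℕ} (x : Fin d → ℕ) (k : ℕ) : ℕ :=
  if h : k < d then x ⟨k, h⟩ else 0

theorem mem_columnRange_iff {a n : ℕ → ℕ} (k y : ℕ) :
    y ∈ columnRange a n k ↔ n k ≤ y ∧ y ≤ a k ∧ ∀ j, j + 1 = k → y ≤ n j := by
  cases k with
  | zero => simp [columnRange]
  | succ k => simp [columnRange]

theorem hasSum_inversionCoeff_mul_surNumber {p : ℕ} (hp : 1 < p) {a : ℕ → ℕ} (ha : Antitone a)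
    {ν : YoungDiagram} {d : ℕ} (hν : ν.rowLen 0 ≤ d) :
    HasSum (fun μ : {μ : YoungDiagram //
        μ ∈ partitionsConjLenLE d ∧ Interlaces ν.transpose μ.transpose} =>
      inversionCoeff (1 / (p : ℝ)) ν μ * surNumber p a μ)
      (if ∀ k < d, a k = ν.colLen k then 1 else 0) := by
  classical
  set g : (Fin d → ℕ) → ℝ := fun x =>
    if x ∈ Fintype.piFinset (fun k : Fin d => columnRange a ν.colLen k) then
      (∏ k : Fin d, columnFactor (1 / (p : ℝ)) p (a k) (ν.colLen k) (x k) *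
        linkFactor (1 / (p : ℝ)) a ν.colLen k (x k)) * linkFactor (1 / (p : ℝ)) a ν.colLen d 0
    else 0 with hg
  have hgsum : HasSum g (if ∀ k < d, a k = ν.colLen k then 1 else 0) := by
    rw [← sum_prod_columns hp ha d, Finset.sum_mul]
    have h1 := hasSum_sum_of_ne_finset_zero (f := g) (L := SummationFilter.unconditional _)
      (s := Fintype.piFinset (fun k : Fin d => columnRange a ν.colLen k))
      (fun x hx => if_neg hx)
    rwa [Finset.sum_congr rfl fun x hx => if_pos hx] at h1
  set e : {μ : YoungDiagram //
      μ ∈ partitionsConjLenLE d ∧ Interlaces ν.transpose μ.transpose} → Fin d → ℕ :=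
    fun μ k => μ.1.colLen k with he
  have hinj : Function.Injective e := by
    rintro ⟨μ, hμ, hint⟩ ⟨μ', hμ', hint'⟩ heq
    rw [mem_partitionsConjLenLE_iff] at hμ hμ'
    refine Subtype.ext (YoungDiagram.ext_colLen fun k => ?_)
    rcases lt_or_ge k d with hk | hk
    · exact congrFun heq ⟨k, hk⟩
    · simp only [YoungDiagram.colLen_eq_zero hμ hk, YoungDiagram.colLen_eq_zero hμ' hk]
  have hrange : ∀ x ∉ Set.range e, g x = 0 := by
    intro x hx
    refine if_neg fun hmem => hx ?_
    rw [Fintype.mem_piFinset] at hmem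
    simp only [mem_columnRange_iff] at hmem
    have hinter : ∀ k, ν.colLen k ≤ extendByZero x k ∧ extendByZero x (k + 1) ≤ ν.colLen k := by
      intro k
      constructor
      · by_cases hk : k < d
        · rw [extendByZero, dif_pos hk]; exact (hmem ⟨k, hk⟩).1
        · rw [YoungDiagram.colLen_eq_zero hν (not_lt.1 hk)]; exact Nat.zero_le _
      · by_cases hk : k + 1 < d
        · rw [extendByZero, dif_pos hk]; exact (hmem ⟨k + 1, hk⟩).2.2 k rfl
        · rw [extendByZero, dif_neg hk]; exact Nat.zero_le _
    have hanti : Antitone (extendByZero x) :=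
      antitone_nat_of_succ_le fun k => (hinter k).2.trans (hinter k).1
    have hcol : ∀ k, (YoungDiagram.ofColLens d _ hanti).colLen k = extendByZero x k := by
      intro k
      rw [YoungDiagram.colLen_ofColLens]
      split_ifs with hk
      · rfl
      · rw [extendByZero, dif_neg hk]
    refine ⟨⟨YoungDiagram.ofColLens d _ hanti, ?_, ?_⟩, ?_⟩
    · rw [mem_partitionsConjLenLE_iff]
      exact YoungDiagram.rowLen_zero_le (by rw [hcol, extendByZero, dif_neg (lt_irrefl d)])
    · rw [interlaces_transpose_iff]
      intro k
      rw [hcol, hcol]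
      exact hinter k
    · funext k
      simp only [he]
      rw [hcol, extendByZero, dif_pos k.2]
  rw [← hinj.hasSum_iff hrange] at hgsum
  convert hgsum using 1
  funext ⟨μ, hμ, hint⟩
  rw [mem_partitionsConjLenLE_iff] at hμ
  rw [interlaces_transpose_iff] at hint
  by_cases hle : ∀ k < d, μ.colLen k ≤ a k
  · rw [Function.comp_apply, hg]
    simp only [he]
    rw [if_pos, inversionCoeff_mul_surNumber hp hν hμ (fun k => (hint k).1) hle,
      Finset.prod_range]
    rw [Fintype.mem_piFinset]
    intro k
    rw [mem_columnRange_iff]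
    refine ⟨(hint k).1, hle k k.2, ?_⟩
    rintro j hj
    rw [← hj]
    exact (hint j).2
  · push Not at hle
    obtain ⟨k, hk, hlt⟩ := hle
    rw [surNumber_eq_zero p ha hlt, Nat.cast_zero, mul_zero]
    refine (if_neg fun hmem => ?_).symm
    rw [Fintype.mem_piFinset] at hmem
    have := hmem ⟨k, hk⟩
    rw [mem_columnRange_iff] at this
    exact absurd this.2.1 (not_le.2 hlt)

theorem AddSubgroup.card_comap_of_le_range {X V : Type*} [AddCommGroup X] [AddCommGroup V]
    (r : X →+ V) {S : AddSubgroup V} (hS : S ≤ r.range) :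
    Nat.card (S.comap r) = Nat.card r.ker * Nat.card S := by
  have h := AddSubgroup.relIndex_mul_relIndex ⊥ r.ker (S.comap r) bot_le
    (AddMonoidHom.ker_le_comap r S)
  rwa [AddSubgroup.relIndex_bot_left, AddSubgroup.relIndex_bot_left, AddSubgroup.relIndex_ker,
    AddSubgroup.map_comap_eq_self hS, eq_comm] at h

section

variable {K V : Type*} [Field K] [AddCommGroup V] [Module K V]

theorem card_notMem_of_le_range {X : Type*} [AddCommGroup X] [Finite X] (r : X →+ V)
    {S U : Submodule K V} (hU : U.toAddSubgroup = r.range) (hS : S ≤ U) :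
    Nat.card {z : X // r z ∉ S} =
      Nat.card r.ker * (Nat.card K ^ Module.finrank K U - Nat.card K ^ Module.finrank K S) := by
  have hfinU : Finite U := by
    have : Finite r.range := Set.finite_range r
    rw [← hU] at this
    exact this
  have hfinS : Finite S := Finite.of_injective _ (Submodule.inclusion_injective hS)
  have h1 := AddSubgroup.card_comap_of_le_range r (S := S.toAddSubgroup)
    (by rw [← hU]; exact hS)
  have h2 := AddSubgroup.card_comap_of_le_range r (S := U.toAddSubgroup) hU.le
  have hcU : Nat.card U.toAddSubgroup = Nat.card K ^ Module.finrank K U :=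
    Module.natCard_eq_pow_finrank (V := U)
  have hcS : Nat.card S.toAddSubgroup = Nat.card K ^ Module.finrank K S :=
    Module.natCard_eq_pow_finrank (V := S)
  have htop : U.toAddSubgroup.comap r = ⊤ := by
    rw [hU, eq_top_iff]; exact fun x _ => ⟨x, rfl⟩
  rw [htop, AddSubgroup.card_top, hcU] at h2
  rw [hcS] at h1
  have h3 := Set.ncard_add_ncard_compl ((S.toAddSubgroup.comap r : AddSubgroup X) : Set X)
  rw [h2] at h3
  have h4 : ((S.toAddSubgroup.comap r : AddSubgroup X) : Set X).ncard = _ := h1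
  have h5 : Nat.card {z : X // r z ∉ S} =
    ((S.toAddSubgroup.comap r : AddSubgroup X) : Set X)ᶜ.ncard := rfl
  rw [h5, Nat.mul_sub]
  omega

theorem card_linearIndependent_tuples (X : ℕ → Type*) [∀ i, AddCommGroup (X i)]
    [∀ i, Finite (X i)] (r : ∀ i, X i →+ V) (U : ℕ → Submodule K V)
    (hU : ∀ i, (U i).toAddSubgroup = (r i).range) (l : ℕ) (hmono : ∀ i j, i ≤ j → j < l → U i ≤ U j) :
    Nat.card {x : ∀ i : Fin l, X i // LinearIndependent K fun i : Fin l => r i (x i)} =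
      ∏ i ∈ Finset.range l,
        Nat.card (r i).ker * (Nat.card K ^ Module.finrank K (U i) - Nat.card K ^ i) := by
  induction l with
  | zero =>
    rw [Finset.range_zero, Finset.prod_empty, Nat.card_eq_one_iff_unique]
    exact ⟨⟨fun x y => Subtype.ext (Subsingleton.elim _ _)⟩,
      ⟨⟨fun i => i.elim0, linearIndependent_empty_type⟩⟩⟩
  | succ l ih =>
    rw [Finset.prod_range_succ, ← ih fun i j hij hj => hmono i j hij (hj.trans l.lt_succ_self)]
    let e : {x : ∀ i : Fin (l + 1), X i // LinearIndependent K fun i : Fin (l + 1) => r i (x i)} ≃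
        Σ y : {x : ∀ i : Fin l, X i // LinearIndependent K fun i : Fin l => r i (x i)},
          {z : X l // r l z ∉ Submodule.span K (Set.range fun i : Fin l => r i (y.1 i))} :=
      { toFun := fun x => ⟨⟨fun i => x.1 i.castSucc, (linearIndependent_finSucc'.1 x.2).1⟩,
          ⟨x.1 (Fin.last l), (linearIndependent_finSucc'.1 x.2).2⟩⟩
        invFun := fun w => ⟨Fin.snoc (α := fun i : Fin (l + 1) => X i) w.1.1 w.2.1, by
          rw [linearIndependent_finSucc']
          have h1 : (Fin.init fun i : Fin (l + 1) =>
              r i (Fin.snoc (α := fun i : Fin (l + 1) => X i) w.1.1 w.2.1 i)) =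
              fun i : Fin l => r i (w.1.1 i) := by
            funext i
            simp only [Fin.init, Fin.snoc_castSucc]
            rfl
          rw [h1]
          simp only [Fin.snoc_last]
          exact ⟨w.1.2, w.2.2⟩⟩
        left_inv := fun x => Subtype.ext (Fin.snoc_init_self x.1)
        right_inv := by
          rintro ⟨⟨y, hy⟩, ⟨z, hz⟩⟩
          have h1 : (fun i : Fin l =>
              Fin.snoc (α := fun i : Fin (l + 1) => X i) y z i.castSucc) = y := by
            funext i; rw [Fin.snoc_castSucc]
          have h2 : Fin.snoc (α := fun i : Fin (l + 1) => X i) y z (Fin.last l) = z :=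
            Fin.snoc_last ..
          exact Sigma.subtype_ext (Subtype.ext h1) h2 }
    have := Fintype.ofFinite
      {x : ∀ i : Fin l, X i // LinearIndependent K fun i : Fin l => r i (x i)}
    rw [Nat.card_congr e, Nat.card_sigma, Finset.sum_congr rfl (g := fun _ =>
        Nat.card (r l).ker * (Nat.card K ^ Module.finrank K (U l) - Nat.card K ^ l)),
      Finset.sum_const, Finset.card_univ, smul_eq_mul, ← Nat.card_eq_fintype_card]
    rintro ⟨y, hy⟩ -
    rw [card_notMem_of_le_range (r l) (hU l), finrank_span_eq_card hy, Fintype.card_fin]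
    rw [Submodule.span_le]
    rintro _ ⟨i, rfl⟩
    refine hmono i l i.2.le l.lt_succ_self ?_
    have : r i (y i) ∈ (U i).toAddSubgroup := by rw [hU]; exact ⟨_, rfl⟩
    exact this

end

section

variable (p : ℕ)

/-- The reduction `ℤ / p ^ e → ℤ / p` (and `0` for `e = 0`). -/
noncomputable def reductionHom (e : ℕ) : ZMod (p ^ e) →+ ZMod p :=
  if h : p ∣ p ^ e then (ZMod.castHom h (ZMod p)).toAddMonoidHom else 0

theorem reductionHom_intCast (e : ℕ) (z : ℤ) :
    reductionHom p (e + 1) (z : ZMod (p ^ (e + 1))) = (z : ZMod p) := by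
  rw [reductionHom, dif_pos (dvd_pow_self p e.succ_ne_zero)]
  exact map_intCast (ZMod.castHom (dvd_pow_self p e.succ_ne_zero) (ZMod p)) z

/-- The map `ℤ / p ^ e → ℤ / p ^ (e + 1)` given by multiplication by `p`. -/
noncomputable def mulHom (e : ℕ) : ZMod (p ^ e) →+ ZMod (p ^ (e + 1)) :=
  ZMod.lift (p ^ e) ⟨zmultiplesHom _ ((p : ℤ) : ZMod (p ^ (e + 1))), by
    rw [zmultiplesHom_apply, zsmul_eq_mul, ← Int.cast_mul, ZMod.intCast_zmod_eq_zero_iff_dvd]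
    push_cast
    rw [pow_succ]⟩

theorem mulHom_intCast (e : ℕ) (z : ℤ) :
    mulHom p e (z : ZMod (p ^ e)) = ((z * p : ℤ) : ZMod (p ^ (e + 1))) := by
  rw [mulHom, ZMod.lift_coe, zmultiplesHom_apply, zsmul_eq_mul, ← Int.cast_mul]

variable [hp : Fact p.Prime]

theorem mulHom_injective (e : ℕ) : Function.Injective (mulHom p e) := by
  rw [injective_iff_map_eq_zero]
  intro x hx
  obtain ⟨z, rfl⟩ := ZMod.intCast_surjective x
  rw [mulHom_intCast, ZMod.intCast_zmod_eq_zero_iff_dvd] at hx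
  rw [ZMod.intCast_zmod_eq_zero_iff_dvd]
  push_cast at hx ⊢
  rw [pow_succ] at hx
  exact Int.dvd_of_mul_dvd_mul_right (by exact_mod_cast hp.out.ne_zero) hx

theorem range_mulHom (e : ℕ) : (mulHom p e).range = (reductionHom p (e + 1)).ker := by
  ext x
  obtain ⟨z, rfl⟩ := ZMod.intCast_surjective x
  rw [AddMonoidHom.mem_ker, reductionHom_intCast, ZMod.intCast_zmod_eq_zero_iff_dvd]
  constructor
  · rintro ⟨y, hy⟩
    obtain ⟨w, rfl⟩ := ZMod.intCast_surjective y
    rw [mulHom_intCast, ZMod.intCast_eq_intCast_iff_dvd_sub] at hy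
    have h1 : (p : ℤ) ∣ z - w * p := by
      refine dvd_trans ?_ hy
      push_cast
      exact dvd_pow_self _ e.succ_ne_zero
    exact (dvd_sub_left (Dvd.intro_left w rfl)).1 h1
  · rintro ⟨w, rfl⟩
    exact ⟨(w : ZMod (p ^ e)), by rw [mulHom_intCast, mul_comm]⟩

/-- Postcomposition with the reduction modulo `p`. -/
noncomputable def homReduction (A : Type*) [AddCommGroup A] (e : ℕ) :
    (A →+ ZMod (p ^ e)) →+ (A →+ ZMod p) :=
  AddMonoidHom.compHom (reductionHom p e)

theorem card_ker_homReduction (A : Type*) [AddCommGroup A] (e : ℕ) :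
    Nat.card (homReduction p A (e + 1)).ker = Nat.card (A →+ ZMod (p ^ e)) := by
  have hinj : Function.Injective (AddMonoidHom.compHom (M := A) (mulHom p e)) := by
    intro f g hfg
    ext x
    exact mulHom_injective p e (DFunLike.congr_fun hfg x)
  have hrange : (AddMonoidHom.compHom (M := A) (mulHom p e)).range =
      (homReduction p A (e + 1)).ker := by
    ext f
    rw [AddMonoidHom.mem_ker, AddMonoidHom.mem_range]
    constructor
    · rintro ⟨g, rfl⟩
      ext x
      have : mulHom p e (g x) ∈ (reductionHom p (e + 1)).ker := by
        rw [← range_mulHom]; exact ⟨_, rfl⟩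
      exact this
    · intro hf
      have hmem : ∀ x, f x ∈ (mulHom p e).range := by
        intro x
        rw [range_mulHom]
        exact DFunLike.congr_fun hf x
      let s := (AddMonoidHom.ofInjective (mulHom_injective p e)).symm
      refine ⟨s.toAddMonoidHom.comp (f.codRestrict _ hmem), ?_⟩
      ext x
      have := (AddMonoidHom.ofInjective (mulHom_injective p e)).apply_symm_apply ⟨f x, hmem x⟩
      exact congrArg Subtype.val this
  rw [← hrange]
  exact (Nat.card_congr (AddMonoidHom.ofInjective hinj).toEquiv).symm

theorem finite_hom_zmod_pow {A : Type*} [AddCommGroup A] [Finite (A →+ ZMod p)] (e : ℕ) :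
    Finite (A →+ ZMod (p ^ e)) := by
  induction e with
  | zero =>
    rw [pow_zero]
    exact Finite.of_injective (fun _ => ()) fun f g _ => by
      ext x; exact Subsingleton.elim (α := ZMod 1) _ _
  | succ e ih =>
    rw [(homReduction p A (e + 1)).finite_iff_finite_ker_range]
    refine ⟨?_, inferInstance⟩
    refine Nat.finite_of_card_ne_zero ?_
    rw [card_ker_homReduction]
    exact Nat.card_pos.ne'

/-- The homomorphisms `A → ℤ / p` that lift to `ℤ / p ^ e`. -/
noncomputable def liftableHoms (A : Type*) [AddCommGroup A] (e : ℕ) :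
    Submodule (ZMod p) (A →+ ZMod p) :=
  AddSubgroup.toZModSubmodule p (homReduction p A e).range

/-- The `k`-th column length of the type of `A / p ^ d A`, for `k < d`. -/
noncomputable def homRank (A : Type*) [AddCommGroup A] (k : ℕ) : ℕ :=
  Module.finrank (ZMod p) (liftableHoms p A (k + 1))

theorem liftableHoms_succ_le (A : Type*) [AddCommGroup A] (e : ℕ) :
    liftableHoms p A (e + 2) ≤ liftableHoms p A (e + 1) := by
  rintro _ ⟨f, rfl⟩
  refine ⟨((ZMod.castHom (pow_dvd_pow p (e + 1).le_succ)
    (ZMod (p ^ (e + 1)))).toAddMonoidHom).comp f, ?_⟩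
  ext x
  obtain ⟨z, hz⟩ := ZMod.intCast_surjective (f x)
  change reductionHom p (e + 1)
    (ZMod.castHom (pow_dvd_pow p (e + 1).le_succ) (ZMod (p ^ (e + 1))) (f x)) = reductionHom p (e + 2) (f x)
  rw [← hz, map_intCast, reductionHom_intCast, reductionHom_intCast]

theorem antitone_liftableHoms (A : Type*) [AddCommGroup A] :
    Antitone fun k => liftableHoms p A (k + 1) :=
  antitone_nat_of_succ_le fun k => liftableHoms_succ_le p A k

theorem antitone_homRank (A : Type*) [AddCommGroup A] [Finite (A →+ ZMod p)] :
    Antitone (homRank p A) :=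
  fun _ _ h => Submodule.finrank_mono (antitone_liftableHoms p A h)

theorem card_hom_zmod_pow (A : Type*) [AddCommGroup A] [Finite (A →+ ZMod p)] (e : ℕ) :
    Nat.card (A →+ ZMod (p ^ e)) = p ^ ∑ k ∈ Finset.range e, homRank p A k := by
  induction e with
  | zero =>
    rw [pow_zero, Finset.range_zero, Finset.sum_empty, pow_zero, Nat.card_eq_one_iff_unique]
    exact ⟨⟨fun f g => by ext x; exact Subsingleton.elim (α := ZMod 1) _ _⟩, inferInstance⟩
  | succ e ih =>
    have h1 : Nat.card (homReduction p A (e + 1)).range = p ^ homRank p A e := by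
      have := Module.natCard_eq_pow_finrank (K := ZMod p) (V := liftableHoms p A (e + 1))
      rwa [Nat.card_zmod] at this
    rw [← (homReduction p A (e + 1)).ker.card_mul_index, AddSubgroup.index_ker, h1,
      card_ker_homReduction, ih, Finset.sum_range_succ, pow_add]

end

section

variable (p : ℕ) [hp : Fact p.Prime]

theorem exists_nsmul_of_reductionHom_eq_zero {e : ℕ} (he : e ≠ 0) {x : ZMod (p ^ e)}
    (hx : reductionHom p e x = 0) : ∃ w, x = p • w := by
  obtain ⟨e, rfl⟩ := Nat.exists_eq_succ_of_ne_zero he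
  obtain ⟨z, rfl⟩ := ZMod.intCast_surjective x
  rw [reductionHom_intCast, ZMod.intCast_zmod_eq_zero_iff_dvd] at hx
  obtain ⟨w, rfl⟩ := hx
  exact ⟨w, by push_cast; rw [nsmul_eq_mul]⟩

theorem reductionHom_one {e : ℕ} (he : e ≠ 0) : reductionHom p e 1 = 1 := by
  obtain ⟨e, rfl⟩ := Nat.exists_eq_succ_of_ne_zero he
  simpa using reductionHom_intCast p e 1

theorem surjective_of_surjective_reduction {A : Type*} [AddCommGroup A] {l : ℕ} {e : Fin l → ℕ}
    (he : ∀ i, e i ≠ 0) (f : A →+ ∀ i, ZMod (p ^ e i))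
    (h : ∀ y : Fin l → ZMod p, ∃ a, ∀ i, reductionHom p (e i) (f a i) = y i) :
    Function.Surjective f := by
  have step : ∀ y : ∀ i, ZMod (p ^ e i), ∃ a w, y = f a + p • w := by
    intro y
    obtain ⟨a, ha⟩ := h fun i => reductionHom p (e i) (y i)
    choose w hw using fun i => exists_nsmul_of_reductionHom_eq_zero p (he i)
      (x := y i - f a i) (by rw [map_sub, ha, sub_self])
    refine ⟨a, w, ?_⟩
    funext i
    rw [Pi.add_apply, Pi.smul_apply, ← hw i, add_sub_cancel]
  have iter : ∀ (k : ℕ) (y : ∀ i, ZMod (p ^ e i)), ∃ a w, y = f a + p ^ k • w := by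
    intro k
    induction k with
    | zero => exact fun y => ⟨0, y, by rw [map_zero, zero_add, pow_zero, one_smul]⟩
    | succ k ih =>
      intro y
      obtain ⟨a, w, rfl⟩ := ih y
      obtain ⟨b, v, rfl⟩ := step w
      refine ⟨a + p ^ k • b, v, ?_⟩
      rw [map_add, map_nsmul, smul_add, smul_smul, pow_succ, add_assoc]
  intro y
  obtain ⟨a, w, rfl⟩ := iter (∑ i, e i) y
  refine ⟨a, ?_⟩
  have hz : p ^ (∑ i, e i) • w = 0 := by
    funext i
    have hle : e i ≤ ∑ i, e i := Finset.single_le_sum (fun _ _ => Nat.zero_le _) (Finset.mem_univ i)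
    rw [Pi.smul_apply, nsmul_eq_mul, Nat.cast_pow, ZMod.natCast_pow_eq_zero_of_le p hle, zero_mul,
      Pi.zero_apply]
  rw [hz, add_zero]

theorem surjective_pi_iff_linearIndependent {A : Type*} [AddCommGroup A] {l : ℕ} {e : Fin l → ℕ}
    (he : ∀ i, e i ≠ 0) (g : ∀ i, A →+ ZMod (p ^ e i)) :
    Function.Surjective (AddMonoidHom.pi g) ↔
      LinearIndependent (ZMod p) fun i => homReduction p A (e i) (g i) := by
  classical
  constructor
  · intro h
    rw [Fintype.linearIndependent_iff]
    intro c hc i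
    obtain ⟨x, hx⟩ := h (Pi.single i 1)
    have h1 := DFunLike.congr_fun hc x
    rw [AddMonoidHom.finsetSum_apply, Finset.sum_eq_single i] at h1
    · have h2 : g i x = 1 := by simpa using congrFun hx i
      change c i * reductionHom p (e i) (g i x) = 0 at h1
      rwa [h2, reductionHom_one p (he i), mul_one] at h1
    · intro j _ hj
      have h2 : g j x = 0 := by simpa [hj] using congrFun hx j
      change c j * reductionHom p (e j) (g j x) = 0
      rw [h2, map_zero, mul_zero]
    · exact fun h => absurd (Finset.mem_univ i) h
  · intro h
    let r : A →+ (Fin l → ZMod p) := AddMonoidHom.pi fun i => homReduction p A (e i) (g i)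
    suffices hr : AddSubgroup.toZModSubmodule p r.range = ⊤ by
      refine surjective_of_surjective_reduction p he _ fun y => ?_
      have hy : y ∈ AddSubgroup.toZModSubmodule p r.range := by rw [hr]; trivial
      obtain ⟨a, ha⟩ := hy
      exact ⟨a, fun i => congrFun ha i⟩
    by_contra hne
    obtain ⟨φ, hφ, hle⟩ := Submodule.exists_le_ker_of_lt_top _ (lt_top_iff_ne_top.2 hne)
    refine hφ ?_
    have hφ' : ∀ y : Fin l → ZMod p, φ y = ∑ i, φ (Pi.single i 1) * y i := by
      intro y
      conv_lhs => rw [pi_eq_sum_univ' y]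
      rw [map_sum]
      refine Finset.sum_congr rfl fun i _ => ?_
      rw [map_smul, smul_eq_mul, mul_comm]
    have hc := Fintype.linearIndependent_iff.1 h (fun i => φ (Pi.single i 1)) (by
      ext x
      rw [AddMonoidHom.finsetSum_apply]
      have h1 : φ (r x) = 0 := hle ⟨x, rfl⟩
      rw [hφ'] at h1
      exact h1)
    refine LinearMap.ext fun y => ?_
    rw [hφ']
    exact Finset.sum_eq_zero fun i _ => by rw [hc i, zero_mul]

theorem card_surjective (A : Type*) [AddCommGroup A] [Finite (A →+ ZMod p)] (μ : YoungDiagram) :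
    Nat.card {f : A →+ GroupOfPartition p μ // Function.Surjective f} =
      surNumber p (homRank p A) μ := by
  have hpos : ∀ i : Fin (μ.colLen 0), μ.rowLen i ≠ 0 := fun i => by
    have := (μ.lt_colLen_iff_lt_rowLen i 0).1 i.2
    omega
  have := fun e => finite_hom_zmod_pow p (A := A) e
  let e : {f : A →+ GroupOfPartition p μ // Function.Surjective f} ≃
      {x : ∀ i : Fin (μ.colLen 0), A →+ ZMod (p ^ μ.rowLen i) // LinearIndependent (ZMod p)
        fun i : Fin (μ.colLen 0) => homReduction p A (μ.rowLen i) (x i)} :=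
    { toFun := fun f => ⟨fun i => (Pi.evalAddMonoidHom _ i).comp f.1,
        (surjective_pi_iff_linearIndependent p hpos _).1 f.2⟩
      invFun := fun x => ⟨AddMonoidHom.pi x.1,
        (surjective_pi_iff_linearIndependent p hpos _).2 x.2⟩
      left_inv := fun f => rfl
      right_inv := fun x => rfl }
  rw [Nat.card_congr e, card_linearIndependent_tuples (fun i => A →+ ZMod (p ^ μ.rowLen i))
    (fun i => homReduction p A (μ.rowLen i)) (fun i => liftableHoms p A (μ.rowLen i)) (fun i => rfl),
    surNumber]
  · refine Finset.prod_congr rfl fun i hi => ?_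
    obtain ⟨r, hr⟩ := Nat.exists_eq_succ_of_ne_zero (hpos ⟨i, Finset.mem_range.1 hi⟩)
    rw [show μ.rowLen i = r + 1 from hr, card_ker_homReduction, card_hom_zmod_pow, Nat.card_zmod,
      Nat.add_sub_cancel, homRank]
  · intro i j hij hj
    obtain ⟨r, hr⟩ := Nat.exists_eq_succ_of_ne_zero (hpos ⟨i, hij.trans_lt hj⟩)
    obtain ⟨s, hs⟩ := Nat.exists_eq_succ_of_ne_zero (hpos ⟨j, hj⟩)
    have h1 := μ.rowLen_anti i j hij
    dsimp only at hr hs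
    rw [hr, hs] at h1 ⊢
    exact antitone_liftableHoms p A (Nat.succ_le_succ_iff.1 h1)

theorem finite_hom_groupOfPartition (A : Type*) [AddCommGroup A] [Finite (A →+ ZMod p)]
    (μ : YoungDiagram) : Finite (A →+ GroupOfPartition p μ) := by
  have := fun e => finite_hom_zmod_pow p (A := A) e
  refine Finite.of_injective (β := ∀ i : Fin (μ.colLen 0), A →+ ZMod (p ^ μ.rowLen i))
    (fun f i => (Pi.evalAddMonoidHom _ i).comp f) fun f g h => ?_
  ext x i
  exact DFunLike.congr_fun (congrFun h i) x

theorem surCount_groupOfPartition (A : Type*) [AddCommGroup A] [Finite (A →+ ZMod p)]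
    (μ : YoungDiagram) :
    surCount A (GroupOfPartition p μ) = (surNumber p (homRank p A) μ : ℝ≥0∞) := by
  have := finite_hom_groupOfPartition p A μ
  rw [surCount, ENat.card_eq_coe_natCard, card_surjective]
  rfl

end

/-- The embedding of `ℤ / n` into `ℚ / ℤ`. -/
noncomputable def zmodToCircle (n : ℕ) : ZMod n →+ AddCircle (1 : ℚ) :=
  ZMod.lift n ⟨zmultiplesHom _ ((1 / n : ℚ) : AddCircle (1 : ℚ)), by
    rw [zmultiplesHom_apply, ← AddCircle.coe_zsmul, AddCircle.coe_eq_zero_iff]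
    rcases eq_or_ne n 0 with rfl | hn
    · exact ⟨0, by simp⟩
    · refine ⟨1, ?_⟩
      have : (n : ℚ) ≠ 0 := Nat.cast_ne_zero.2 hn
      simp [this]⟩

theorem zmodToCircle_intCast (n : ℕ) (z : ℤ) :
    zmodToCircle n (z : ZMod n) = ((z * (1 / n) : ℚ) : AddCircle (1 : ℚ)) := by
  rw [zmodToCircle, ZMod.lift_coe, zmultiplesHom_apply, ← AddCircle.coe_zsmul, zsmul_eq_mul]

theorem zmodToCircle_injective {n : ℕ} (hn : n ≠ 0) : Function.Injective (zmodToCircle n) := by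
  rw [injective_iff_map_eq_zero]
  intro x hx
  obtain ⟨z, rfl⟩ := ZMod.intCast_surjective x
  rw [zmodToCircle_intCast, AddCircle.coe_eq_zero_iff] at hx
  obtain ⟨k, hk⟩ := hx
  have hn' : (n : ℚ) ≠ 0 := Nat.cast_ne_zero.2 hn
  rw [zsmul_eq_mul, mul_one, mul_one_div, eq_div_iff hn'] at hk
  rw [ZMod.intCast_zmod_eq_zero_iff_dvd]
  exact ⟨k, by rw [mul_comm]; exact_mod_cast hk.symm⟩

theorem mem_range_zmodToCircle {n : ℕ} (hn : n ≠ 0) {u : AddCircle (1 : ℚ)} (hu : n • u = 0) :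
    u ∈ (zmodToCircle n).range := by
  have : Fact ((0 : ℚ) < 1) := ⟨one_pos⟩
  obtain ⟨m, -, rfl⟩ := (AddCircle.nsmul_eq_zero_iff (Nat.pos_of_ne_zero hn)).1 hu
  exact ⟨((m : ℤ) : ZMod n), by rw [zmodToCircle_intCast]; push_cast; ring_nf⟩

/-- Homomorphisms to `ℤ / n` separate the points of `A / n A`. -/
theorem mem_multiplesSubgroup_of_forall_hom {A : Type*} [AddCommGroup A] {n : ℕ} (hn : n ≠ 0)
    {x : A} (h : ∀ g : A →+ ZMod n, g x = 0) : x ∈ multiplesSubgroup n A := by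
  rw [← QuotientAddGroup.eq_zero_iff]
  refine CharacterModule.eq_zero_of_character_apply fun c => ?_
  have hmem : ∀ b, c b ∈ (zmodToCircle n).range := by
    intro b
    obtain ⟨a, rfl⟩ := QuotientAddGroup.mk_surjective b
    refine mem_range_zmodToCircle hn ?_
    have h0 : ((n • a : A) : A ⧸ multiplesSubgroup n A) = 0 :=
      (QuotientAddGroup.eq_zero_iff _).2 (AddMonoidHom.mem_range.2 ⟨a, rfl⟩)
    rw [← map_nsmul, ← QuotientAddGroup.mk_nsmul, h0, map_zero]
  let s := AddMonoidHom.ofInjective (zmodToCircle_injective hn)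
  have h1 := h ((s.symm.toAddMonoidHom.comp (AddMonoidHom.codRestrict c _ hmem)).comp
    (QuotientAddGroup.mk' (multiplesSubgroup n A)))
  have h2 : s.symm ⟨c x, hmem x⟩ = 0 := h1
  rw [AddEquiv.map_eq_zero_iff] at h2
  exact congrArg Subtype.val h2

theorem card_hom_zmod_zmod (m n : ℕ) [NeZero n] : Nat.card (ZMod m →+ ZMod n) = n.gcd m := by
  rw [← Nat.card_congr (ZMod.lift m)]
  have h1 := IsAddCyclic.card_nsmulAddMonoidHom_ker (ZMod n) m
  rw [Nat.card_zmod] at h1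
  rw [← h1]
  refine Nat.card_congr (((zmultiplesHom (ZMod n)).subtypeEquiv fun a => ?_).symm)
  rw [AddMonoidHom.mem_ker, nsmulAddMonoidHom_apply, zmultiplesHom_apply, natCast_zsmul]

section

variable (p : ℕ)

theorem Nat.gcd_pow_pow_eq_pow_min (a b : ℕ) : (p ^ a).gcd (p ^ b) = p ^ min a b := by
  rcases le_total a b with h | h
  · rw [min_eq_left h, Nat.gcd_eq_left (pow_dvd_pow p h)]
  · rw [min_eq_right h, Nat.gcd_eq_right (pow_dvd_pow p h)]

theorem pow_nsmul_groupOfPartition {ν : YoungDiagram} {d : ℕ} (hν : ν.rowLen 0 ≤ d)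
    (x : GroupOfPartition p ν) : p ^ d • x = 0 := by
  funext i
  have hle : ν.rowLen i ≤ d := (ν.rowLen_anti 0 i (Nat.zero_le _)).trans hν
  rw [Pi.smul_apply, nsmul_eq_mul, Nat.cast_pow, ZMod.natCast_pow_eq_zero_of_le p hle, zero_mul,
    Pi.zero_apply]

theorem card_hom_quotient_multiples (A : Type*) [AddCommGroup A] {d e : ℕ} (he : e ≤ d) :
    Nat.card ((A ⧸ multiplesSubgroup (p ^ d) A) →+ ZMod (p ^ e)) =
      Nat.card (A →+ ZMod (p ^ e)) := by
  refine Nat.card_congr (Equiv.ofBijective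
    (fun g => g.comp (QuotientAddGroup.mk' (multiplesSubgroup (p ^ d) A))) ⟨?_, ?_⟩)
  · intro g g' h
    refine AddMonoidHom.ext fun b => ?_
    obtain ⟨a, rfl⟩ := QuotientAddGroup.mk_surjective b
    exact DFunLike.congr_fun h a
  · intro f
    refine ⟨QuotientAddGroup.lift _ f ?_, rfl⟩
    rintro _ ⟨a, rfl⟩
    rw [AddMonoidHom.mem_ker, nsmulAddMonoidHom_apply, map_nsmul, nsmul_eq_mul, Nat.cast_pow,
      ZMod.natCast_pow_eq_zero_of_le p he, zero_mul]

variable [hp : Fact p.Prime]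

theorem card_hom_groupOfPartition (ν : YoungDiagram) (e : ℕ) :
    Nat.card (GroupOfPartition p ν →+ ZMod (p ^ e)) =
      p ^ ∑ k ∈ Finset.range e, ν.colLen k := by
  have hsum : ∑ i ∈ Finset.range (ν.colLen 0), min e (ν.rowLen i) =
      ∑ k ∈ Finset.range e, ν.colLen k := by
    have h1 := Finset.sum_comm' (s := Finset.range (ν.colLen 0))
      (t := fun i => Finset.range (min e (ν.rowLen i))) (t' := Finset.range e)
      (s' := fun k => Finset.range (ν.colLen k)) (f := fun _ _ => 1) (fun i k => by
        simp only [Finset.mem_range, lt_min_iff, YoungDiagram.lt_colLen_iff_lt_rowLen]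
        omega)
    simpa using h1
  rw [Nat.card_congr (Pi.addMonoidHomAddEquiv (fun i : Fin (ν.colLen 0) => ZMod (p ^ ν.rowLen i))
    (ZMod (p ^ e))).toEquiv, Nat.card_pi, Finset.prod_congr rfl fun i _ => card_hom_zmod_zmod _ _,
    Finset.prod_congr rfl fun i _ => Nat.gcd_pow_pow_eq_pow_min _ _ _, Finset.prod_pow_eq_pow_sum,
    Fin.sum_univ_eq_sum_range (fun i => min e (ν.rowLen i)), hsum]

/-- `A / p ^ d A` has type `ν` exactly if its ranks are the column lengths of `ν`. -/
theorem nonempty_addEquiv_iff (A : Type*) [AddCommGroup A] [Finite (A →+ ZMod p)]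
    {ν : YoungDiagram} {d : ℕ} (hν : ν.rowLen 0 ≤ d) :
    Nonempty ((A ⧸ multiplesSubgroup (p ^ d) A) ≃+ GroupOfPartition p ν) ↔
      ∀ k < d, homRank p A k = ν.colLen k := by
  constructor
  · rintro ⟨φ⟩
    have key : ∀ e ≤ d, ∑ k ∈ Finset.range e, homRank p A k =
        ∑ k ∈ Finset.range e, ν.colLen k := by
      intro e he
      refine Nat.pow_right_injective hp.out.two_le ?_
      dsimp only
      rw [← card_hom_zmod_pow, ← card_hom_groupOfPartition p ν e,
        ← card_hom_quotient_multiples p A he]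
      exact Nat.card_congr φ.addMonoidHomCongrLeft.toEquiv
    intro k hk
    have h1 := key (k + 1) hk
    rw [Finset.sum_range_succ, Finset.sum_range_succ, key k hk.le] at h1
    exact Nat.add_left_cancel h1
  · intro h
    have hne := surNumber_ne_zero hp.out.one_lt (a := homRank p A) (μ := ν)
      fun k hk => (h k (hk.trans_le hν)).ge
    rw [← card_surjective] at hne
    obtain ⟨f, hf⟩ := (Nat.card_ne_zero.1 hne).1
    have hfin := finite_hom_zmod_pow p (A := A) d
    have hinj : Function.Injective
        fun g : GroupOfPartition p ν →+ ZMod (p ^ d) => g.comp f := by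
      intro g g' hgg
      refine AddMonoidHom.ext fun b => ?_
      obtain ⟨a, rfl⟩ := hf b
      exact DFunLike.congr_fun hgg a
    have hbij := hinj.bijective_of_nat_card_le (by
      rw [card_hom_groupOfPartition p ν d, card_hom_zmod_pow,
        Finset.sum_congr rfl fun k hk => h k (Finset.mem_range.1 hk)])
    have hker : multiplesSubgroup (p ^ d) A = f.ker := by
      refine le_antisymm ?_ fun x hx => ?_
      · rintro _ ⟨a, rfl⟩
        rw [AddMonoidHom.mem_ker, nsmulAddMonoidHom_apply, map_nsmul,
          pow_nsmul_groupOfPartition p hν]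
      · refine mem_multiplesSubgroup_of_forall_hom (pow_ne_zero d hp.out.ne_zero) fun g => ?_
        obtain ⟨g', rfl⟩ := hbij.2 g
        rw [AddMonoidHom.mem_ker] at hx
        exact (congrArg g' hx).trans (map_zero g')
    exact ⟨(QuotientAddGroup.quotientAddEquivOfEq hker).trans
      (QuotientAddGroup.quotientKerEquivOfSurjective f hf)⟩

end

section

variable (p : ℕ) [hp : Fact p.Prime]

theorem finite_hom_of_surCount_ne_top {A : Type*} [AddCommGroup A]
    (h : surCount A (ZMod p) ≠ ∞) : Finite (A →+ ZMod p) := by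
  have h1 : ENat.card {f : A →+ ZMod p // Function.Surjective f} ≠ ⊤ := by
    intro h2
    rw [surCount, h2] at h
    exact h rfl
  have hfin : {f : A →+ ZMod p | Function.Surjective f}.Finite :=
    not_infinite_iff_finite.1 fun hinf => h1 (ENat.card_eq_top.2 hinf)
  rw [← Set.finite_univ_iff]
  refine (hfin.insert 0).subset fun f _ => ?_
  have : Fact (Nat.card (ZMod p)).Prime := by rw [Nat.card_zmod]; exact hp
  rcases f.range.eq_bot_or_eq_top_of_prime_card with hb | ht
  · exact Or.inl (AddMonoidHom.range_eq_bot_iff.1 hb)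
  · exact Or.inr (AddMonoidHom.range_eq_top.1 ht)

theorem exists_ranks_of_surCount_ne_top {A : Type*} [AddCommGroup A] {d : ℕ}
    (h : d ≠ 0 → surCount A (ZMod p) ≠ ∞) :
    ∃ a : ℕ → ℕ, Antitone a ∧
      (∀ μ : YoungDiagram, μ.rowLen 0 ≤ d →
        surCount A (GroupOfPartition p μ) = (surNumber p a μ : ℝ≥0∞)) ∧
      ∀ ν : YoungDiagram, ν.rowLen 0 ≤ d →
        (Nonempty ((A ⧸ multiplesSubgroup (p ^ d) A) ≃+ GroupOfPartition p ν) ↔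
          ∀ k < d, a k = ν.colLen k) := by
  rcases eq_or_ne d 0 with rfl | hd
  · have hcol : ∀ μ : YoungDiagram, μ.rowLen 0 ≤ 0 → μ.colLen 0 = 0 :=
      fun μ hμ => YoungDiagram.colLen_eq_zero hμ le_rfl
    have hsub : ∀ μ : YoungDiagram, μ.rowLen 0 ≤ 0 → Subsingleton (GroupOfPartition p μ) := by
      intro μ hμ
      have : IsEmpty (Fin (μ.colLen 0)) := by rw [hcol μ hμ]; infer_instance
      infer_instance
    refine ⟨0, antitone_const, fun μ hμ => ?_, fun ν hν => ?_⟩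
    · have := hsub μ hμ
      have hu : Nat.card {f : A →+ GroupOfPartition p μ // Function.Surjective f} = 1 :=
        Nat.card_eq_one_iff_unique.2 ⟨⟨fun f g => Subtype.ext
          (AddMonoidHom.ext fun x => Subsingleton.elim _ _)⟩,
          ⟨⟨0, fun y => ⟨0, Subsingleton.elim _ _⟩⟩⟩⟩
      have hfin := Nat.finite_of_card_ne_zero (hu ▸ one_ne_zero)
      rw [surCount, ENat.card_eq_coe_natCard, hu, surNumber, hcol μ hμ]
      simp
    · have := hsub ν hν
      have htop : multiplesSubgroup (p ^ 0) A = ⊤ :=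
        eq_top_iff.2 fun x _ => ⟨x, by rw [nsmulAddMonoidHom_apply, pow_zero, one_nsmul]⟩
      have hq : Subsingleton (A ⧸ multiplesSubgroup (p ^ 0) A)  := by
        rw [htop]; exact QuotientAddGroup.subsingleton_quotient_top
      refine ⟨fun _ k hk => absurd hk k.not_lt_zero, fun _ => ⟨?_⟩⟩
      exact
        { toFun := 0
          invFun := 0
          left_inv := fun _ => Subsingleton.elim _ _
          right_inv := fun _ => Subsingleton.elim _ _
          map_add' := fun _ _ => Subsingleton.elim _ _ }
  · have hfin := finite_hom_of_surCount_ne_top p (h hd)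
    exact ⟨homRank p A, antitone_homRank p A, fun μ _ => surCount_groupOfPartition p A μ,
      fun ν hν => nonempty_addEquiv_iff p A hν⟩

end

instance : Countable YoungDiagram :=
  Function.Injective.countable (f := YoungDiagram.cells) fun _ _ h => YoungDiagram.ext h

/-- A sum of integrable functions that is almost everywhere the indicator of a set computes the
probability of that set. -/
theorem nullMeasurableSet_and_measureReal_eq_tsum {Ω ι : Type*} [MeasurableSpace Ω] [Countable ι]
    {P : Measure Ω} {E : Set Ω} {F : ι → Ω → ℝ} (hF : ∀ i, Integrable (F i) P)
    (hsum : Summable fun i => ∫ ω, ‖F i ω‖ ∂P)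
    (hE : ∀ᵐ ω ∂P, HasSum (fun i => F i ω) (E.indicator (fun _ => (1 : ℝ)) ω)) :
    NullMeasurableSet E P ∧ P.real E = ∑' i, ∫ ω, F i ω ∂P := by
  have hnull : NullMeasurableSet E P := by
    rw [← aemeasurable_indicator_const_iff (1 : ℝ)]
    exact aemeasurable_of_tendsto_metrizable_ae (Filter.atTop : Filter (Finset ι))
      (fun s => Finset.aemeasurable_fun_sum s fun i _ => (hF i).aemeasurable)
      (by simpa only [HasSum, SummationFilter.unconditional_filter] using hE)
  refine ⟨hnull, ?_⟩
  rw [(hasSum_integral_of_summable_integral_norm hF hsum).tsum_eq,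
    integral_congr_ae (hE.mono fun ω h => h.tsum_eq), integral_indicator₀ hnull]
  simp

theorem mainTheorem3 (p : ℕ) (hp : p.Prime) (d : ℕ)
    {Ω : Type*} [MeasurableSpace Ω] (P : Measure Ω) [IsProbabilityMeasure P]
    (G : Ω → Type*) [∀ ω, AddCommGroup (G ω)]
    (hmeas : ∀ (H : Type) [AddCommGroup H] [Finite H], (∀ h : H, p ^ d • h = 0) →
      AEMeasurable (fun ω => surCount (G ω) H) P)
    (hfin : ∀ (H : Type) [AddCommGroup H] [Finite H], (∀ h : H, p ^ d • h = 0) →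
      groupMoment P G H < ∞)
    (ν : YoungDiagram) (hν : ν ∈ partitionsConjLenLE d)
    (hsum : Summable fun μ : {μ : YoungDiagram //
        μ ∈ partitionsConjLenLE d ∧ Interlaces ν.transpose μ.transpose} =>
      |inversionCoeff (1 / (p : ℝ)) ν μ * (groupMoment P G (GroupOfPartition p μ)).toReal|) :
    NullMeasurableSet
      {ω | Nonempty ((G ω ⧸ multiplesSubgroup (p ^ d) (G ω)) ≃+ GroupOfPartition p ν)} P ∧
    P.real {ω | Nonempty ((G ω ⧸ multiplesSubgroup (p ^ d) (G ω)) ≃+ GroupOfPartition p ν)} =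
      ∑' μ : {μ : YoungDiagram //
          μ ∈ partitionsConjLenLE d ∧ Interlaces ν.transpose μ.transpose},
        inversionCoeff (1 / (p : ℝ)) ν μ *
          (groupMoment P G (GroupOfPartition p μ)).toReal := by
  have : Fact p.Prime := ⟨hp⟩
  have hpow : ∀ e, NeZero (p ^ e) := fun e => ⟨pow_ne_zero e hp.ne_zero⟩
  have hkill : ∀ μ : YoungDiagram, μ.rowLen 0 ≤ d → ∀ x : GroupOfPartition p μ, p ^ d • x = 0 :=
    fun μ hμ => pow_nsmul_groupOfPartition p hμ
  have hν' := mem_partitionsConjLenLE_iff.1 hν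
  set E := {ω | Nonempty ((G ω ⧸ multiplesSubgroup (p ^ d) (G ω)) ≃+ GroupOfPartition p ν)} with hE
  let F : {μ : YoungDiagram // μ ∈ partitionsConjLenLE d ∧ Interlaces ν.transpose μ.transpose} →
      Ω → ℝ := fun μ ω => inversionCoeff (1 / (p : ℝ)) ν μ *
        (surCount (G ω) (GroupOfPartition p μ)).toReal
  have hmeasμ : ∀ μ : {μ : YoungDiagram //
      μ ∈ partitionsConjLenLE d ∧ Interlaces ν.transpose μ.transpose},
      AEMeasurable (fun ω => surCount (G ω) (GroupOfPartition p μ)) P :=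
    fun μ => hmeas _ (hkill μ (mem_partitionsConjLenLE_iff.1 μ.2.1))
  have hfinμ : ∀ μ : {μ : YoungDiagram //
      μ ∈ partitionsConjLenLE d ∧ Interlaces ν.transpose μ.transpose},
      ∫⁻ ω, surCount (G ω) (GroupOfPartition p μ) ∂P < ∞ :=
    fun μ => hfin _ (hkill μ (mem_partitionsConjLenLE_iff.1 μ.2.1))
  have hint : ∀ μ, Integrable (F μ) P := fun μ =>
    (integrable_toReal_of_lintegral_ne_top (hmeasμ μ) (hfinμ μ).ne).const_mul _
  have hmoment : ∀ μ : {μ : YoungDiagram //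
      μ ∈ partitionsConjLenLE d ∧ Interlaces ν.transpose μ.transpose},
      ∫ ω, (surCount (G ω) (GroupOfPartition p μ)).toReal ∂P =
        (groupMoment P G (GroupOfPartition p μ)).toReal :=
    fun μ => integral_toReal (hmeasμ μ) (ae_lt_top' (hmeasμ μ) (hfinμ μ).ne)
  have hnorm : Summable fun μ => ∫ ω, ‖F μ ω‖ ∂P := by
    refine hsum.congr fun μ => ?_
    simp only [F, norm_mul, Real.norm_eq_abs, abs_mul, ENNReal.abs_toReal]
    rw [integral_const_mul, hmoment]
  have hsur : ∀ᵐ ω ∂P, d ≠ 0 → surCount (G ω) (ZMod p) ≠ ∞ := by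
    rcases eq_or_ne d 0 with rfl | hd
    · exact Filter.Eventually.of_forall fun _ h => absurd rfl h
    · have hk : ∀ x : ZMod p, p ^ d • x = 0 := by
        intro x
        obtain ⟨e, rfl⟩ := Nat.exists_eq_succ_of_ne_zero hd
        rw [pow_succ', mul_smul, nsmul_eq_mul, ZMod.natCast_self, zero_mul]
      exact (ae_lt_top' (hmeas _ hk) (hfin _ hk).ne).mono fun ω h _ => h.ne
  have hind : ∀ᵐ ω ∂P, HasSum (fun μ => F μ ω) (E.indicator (fun _ => (1 : ℝ)) ω) := by
    filter_upwards [hsur] with ω hω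
    classical
    obtain ⟨a, ha, hcount, hiso⟩ := exists_ranks_of_surCount_ne_top p hω
    have key := hasSum_inversionCoeff_mul_surNumber hp.one_lt ha hν'
    have hval : E.indicator (fun _ => (1 : ℝ)) ω = if ∀ k < d, a k = ν.colLen k then 1 else 0 := by
      rw [Set.indicator_apply]
      exact if_congr (hiso ν hν') rfl rfl
    rw [hval]
    convert key using 1
    funext μ
    simp only [F]
    rw [hcount μ (mem_partitionsConjLenLE_iff.1 μ.2.1), ENNReal.toReal_natCast]
  have h := nullMeasurableSet_and_measureReal_eq_tsum hint hnorm hind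
  refine ⟨h.1, h.2.trans (tsum_congr fun μ => ?_)⟩
  rw [← hmoment, ← integral_const_mul]
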